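/- A \emph{drawing} of a finite simple graph maps its vertices to distinct points of the plane and each edge to a Jordan arc that joins its two end-vertices and contains no other vertex, such that any two edges that share a point other than a vertex cross properly at it (they do not merely touch) and no three edges share a point other than a vertex. All drawings are \emph{simple}: adjacent edges do not cross, and two independent edges (edges without a common end-vertex) cross in at most one point. A graph is \emph{planar} if it has a drawing without crossings, and \emph{$1$-planar} if it has a drawing in which each edge is crossed at most once. Let $G=(V,E)$ be a finite simple graph, let $\overline{E}$ be the set of all unordered pairs of independent edges of $G$, let $k=|\overline{E}|$, and let $\sigma$ be any ordering of $\overline{E}$, with $\sigma(i)$ the $i$-th pair. A \emph{candidate solution} is a binary array $y\in\{0,1\}^k$, where $y[i]=1$ means that the two edges of $\sigma(i)$ are chosen to cross and $y[i]=0$ that they are not. It is a \emph{TRUE solution} if (1) each edge of $G$ belongs to at most one pair $\sigma(i)$ with $y[i]=1$, and (2) the graph $G^*$, obtained from $G$ by replacing, for every $i$ with $y[i]=1$, the two edges of $\sigma(i)$ by a new (dummy) vertex adjacent to their four end-vertices, is planar. \textbf{Lemma.} $G$ is $1$-planar if and only if some candidate solution $y\in\{0,1\}^k$ is a TRUE solution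 of $G$. -/

import Mathlib

namespace SimpleGraph

universe u

/-- The Euclidean plane. -/
abbrev Plane : Type := EuclideanSpace ℝ (Fin 2)

/-- The point sets `A` and `B` cross (properly) at `p`: in some local coordinate system of the plane
centred at `p`, they are the two coordinate axes.  (A point where two arcs merely touch is not a
proper crossing.) -/
def CrossProperlyAt (A B : Set Plane) (p : Plane) : Prop :=
  ∃ φ : OpenPartialHomeomorph Plane (ℝ × ℝ),
    p ∈ φ.source ∧ φ p = (0, 0) ∧
    (∀ q ∈ φ.source, q ∈ A ↔ (φ q).2 = 0) ∧
    (∀ q ∈ φ.source, q ∈ B ↔ (φ q).1 = 0)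

/-- A drawing of a graph in the plane: distinct vertices are distinct points, each edge is a Jordan
arc that joins its two end-vertices and contains no other vertex, two edges that share a
point other than a vertex cross properly there, and no three edges share a point other than a
vertex. -/
structure Drawing {V : Type u} (G : SimpleGraph V) where
  /-- the point representing a vertex -/
  pos : V → Plane
  /-- the point set of the arc representing an edge -/
  arc : G.edgeSet → Set Plane
  pos_injective : Function.Injective pos
  arc_isJordanArc : ∀ (u v : V) (h : G.Adj u v),
    ∃ γ : _root_.Path (pos u) (pos v), Function.Injective γ ∧ Set.range γ = arc ⟨s(u, v), h⟩
  mem_of_pos_mem_arc : ∀ (e : G.edgeSet) (w : V), pos w ∈ arc e → w ∈ (e : Sym2 V)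
  crossProperly : ∀ (e f : G.edgeSet) (p : Plane), e ≠ f → p ∈ arc e → p ∈ arc f →
    p ∉ Set.range pos → CrossProperlyAt (arc e) (arc f) p
  no_three : ∀ (e f g : G.edgeSet) (p : Plane), e ≠ f → e ≠ g → f ≠ g →
    p ∈ arc e → p ∈ arc f → p ∈ arc g → p ∈ Set.range pos

/-- Two edges are independent if they have no common end-vertex. -/
def EdgesIndependent {V : Type u} (e f : Sym2 V) : Prop :=
  ∀ v : V, v ∈ e → v ∉ f

namespace Drawing

variable {V : Type u} {G : SimpleGraph V}

/-- `p` is a crossing of the edges `e` and `f` in the drawing: distinct edges meeting at a point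
that is not a vertex (by definition of a drawing they cross properly there). -/
def IsCrossing (Γ : Drawing G) (e f : G.edgeSet) (p : Plane) : Prop :=
  e ≠ f ∧ p ∈ Γ.arc e ∧ p ∈ Γ.arc f ∧ p ∉ Set.range Γ.pos

/-- A drawing is simple if adjacent edges do not cross and two independent edges cross in at most
one point. -/
def IsSimple (Γ : Drawing G) : Prop :=
  (∀ (e f : G.edgeSet) (p : Plane), Γ.IsCrossing e f p → EdgesIndependent (e : Sym2 V) f) ∧
  (∀ (e f : G.edgeSet) (p q : Plane), Γ.IsCrossing e f p → Γ.IsCrossing e f q → p = q)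

/-- A planar (crossing-free) drawing. -/
def IsCrossingFree (Γ : Drawing G) : Prop :=
  ∀ (e f : G.edgeSet) (p : Plane), ¬ Γ.IsCrossing e f p

/-- Each edge is crossed at most once: it has at most one crossing point, with at most one other
edge. -/
def EachEdgeCrossedAtMostOnce (Γ : Drawing G) : Prop :=
  ∀ e : G.edgeSet, {c : G.edgeSet × Plane | Γ.IsCrossing e c.1 c.2}.Subsingleton

end Drawing

/-- A graph is planar if it has a simple drawing without crossings. -/
def IsPlanar {V : Type u} (G : SimpleGraph V) : Prop :=
  ∃ Γ : Drawing G, Γ.IsSimple ∧ Γ.IsCrossingFree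

/-- A graph is 1-planar if it has a simple drawing in which each edge is crossed at most once. -/
def IsOnePlanar {V : Type u} (G : SimpleGraph V) : Prop :=
  ∃ Γ : Drawing G, Γ.IsSimple ∧ Γ.EachEdgeCrossedAtMostOnce

/-- The set of all unordered pairs of independent edges of `G`. -/
def independentPairs {V : Type u} (G : SimpleGraph V) : Set (Sym2 (Sym2 V)) :=
  {P | ∃ e ∈ G.edgeSet, ∃ f ∈ G.edgeSet, EdgesIndependent e f ∧ P = s(e, f)}

/-- Condition (1) for a binary array `y`: each edge belongs to at most one of the chosen pairs. -/
def CrossedAtMostOnce {V : Type u} (G : SimpleGraph V) {k : ℕ}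
    (σ : Fin k ≃ G.independentPairs) (y : Fin k → Fin 2) : Prop :=
  ∀ e ∈ G.edgeSet, ∀ i j : Fin k, y i = 1 → y j = 1 →
    e ∈ (σ i : Sym2 (Sym2 V)) → e ∈ (σ j : Sym2 (Sym2 V)) → i = j

/-- The adjacency relation of the graph in which every pair of edges chosen by `y` is replaced by a
dummy vertex: the edges of `G` in no chosen pair are kept, those in a chosen pair are deleted,
and the dummy vertex of a pair is joined to the four end-vertices of the two edges. -/
def dummyAdj {V : Type u} (G : SimpleGraph V) {k : ℕ}
    (σ : Fin k ≃ G.independentPairs) (y : Fin k → Fin 2) :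
    V ⊕ {i : Fin k // y i = 1} → V ⊕ {i : Fin k // y i = 1} → Prop
  | Sum.inl u, Sum.inl v => G.Adj u v ∧ ∀ i, y i = 1 → s(u, v) ∉ (σ i : Sym2 (Sym2 V))
  | Sum.inl u, Sum.inr d => ∃ e ∈ (σ d : Sym2 (Sym2 V)), u ∈ e
  | Sum.inr d, Sum.inl u => ∃ e ∈ (σ d : Sym2 (Sym2 V)), u ∈ e
  | Sum.inr _, Sum.inr _ => False

/-- The graph `G*` obtained from `G` by replacing every crossing prescribed by `y` with a dummy
vertex (used for `y` in which each edge is crossed at most once). -/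
def dummyGraph {V : Type u} (G : SimpleGraph V) {k : ℕ}
    (σ : Fin k ≃ G.independentPairs) (y : Fin k → Fin 2) :
    SimpleGraph (V ⊕ {i : Fin k // y i = 1}) where
  Adj := dummyAdj G σ y
  symm := ⟨by
    rintro (u | d) (v | d') h
    · exact ⟨h.1.symm, fun i hi => by rw [Sym2.eq_swap]; exact h.2 i hi⟩
    · exact h
    · exact h
    · exact h⟩
  loopless := ⟨by
    rintro (u | d) h
    · exact G.irrefl h.1
    · exact h⟩

/-- `y` is a `TRUE` solution: each edge is crossed at most once, and `G*` is planar. -/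
def IsTrueSolution {V : Type u} (G : SimpleGraph V) {k : ℕ}
    (σ : Fin k ≃ G.independentPairs) (y : Fin k → Fin 2) : Prop :=
  G.CrossedAtMostOnce σ y ∧ (G.dummyGraph σ y).IsPlanar

end SimpleGraph

/-! A graph is 1-planar exactly when some array of crossing pairs is a `TRUE` solution.

Given a 1-planar drawing, choose the pairs of edges that cross in it. Each crossing point becomes a
dummy vertex and splits its two edges into four half-edges (`IsJordanArc.exists_split`). All common
points of edges are now vertices, so the dummy graph is planar (`Drawing.dummyGraph_isPlanar`).

Conversely, take a crossing-free drawing of the dummy graph. The four arcs at a dummy vertex may be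
wild near it, and may arrive in a cyclic order in which the two edges of the pair would only touch
there. Neither matters: choose small disjoint closed discs around the dummy vertices
(`Drawing.exists_radius`), cut each of the four arcs where it first hits its disc
(`Drawing.exists_arc_to_sphere`), discard the rest, and join the two ends belonging to the same edge
by a chord of the disc. The four ends are distinct points of a circle, so the two chords either miss
each other, and then the edges do not cross at all, or cross in one interior point, where affine
coordinates along the chords exhibit a proper crossing (`Plane.crossProperlyAt_of_chords`). No
straightening of arcs or theorem on Jordan curves is needed.
-/

open Set

/-! ### Jordan arcs -/

/-- `S` is a Jordan arc from `x` to `y`: the range of an injective path. -/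
def IsJordanArc {X : Type*} [TopologicalSpace X] (S : Set X) (x y : X) : Prop :=
  ∃ γ : Path x y, Function.Injective γ ∧ range γ = S

namespace IsJordanArc

variable {X : Type*} [TopologicalSpace X] {S T : Set X} {x y z p : X}

theorem of_injOn {f : ℝ → X} {a b : ℝ} (hab : a < b) (hf : ContinuousOn f (Icc a b))
    (hi : InjOn f (Icc a b)) : IsJordanArc (f '' Icc a b) (f a) (f b) := by
  refine ⟨⟨⟨fun t => f ((iccHomeoI a b hab).symm t), ?_⟩, ?_, ?_⟩, ?_, ?_⟩
  · exact hf.domRestrict.comp (iccHomeoI a b hab).symm.continuous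
  · simp
  · simp
  · intro s t h
    exact (iccHomeoI a b hab).symm.injective
      (Subtype.ext (hi (Subtype.mem _) (Subtype.mem _) h))
  · ext q
    constructor
    · rintro ⟨t, rfl⟩
      exact ⟨_, Subtype.mem _, rfl⟩
    · rintro ⟨t, ht, rfl⟩
      exact ⟨iccHomeoI a b hab ⟨t, ht⟩, by
        change f ((iccHomeoI a b hab).symm (iccHomeoI a b hab ⟨t, ht⟩)) = f t
        simp⟩

theorem exists_parametrization (h : IsJordanArc S x y) :
    ∃ f : ℝ → X, ContinuousOn f (Icc 0 1) ∧ InjOn f (Icc 0 1) ∧ f '' Icc 0 1 = S ∧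
      f 0 = x ∧ f 1 = y := by
  obtain ⟨γ, hγ, rfl⟩ := h
  refine ⟨γ.extend, γ.continuous_extend.continuousOn, ?_, ?_, by simp, by simp⟩
  · intro s hs t ht hst
    rw [γ.extend_apply hs, γ.extend_apply ht] at hst
    simpa using hγ hst
  · ext q
    constructor
    · rintro ⟨t, ht, rfl⟩
      exact ⟨⟨t, ht⟩, (γ.extend_apply ht).symm⟩
    · rintro ⟨t, rfl⟩
      exact ⟨t, t.2, γ.extend_apply t.2⟩

theorem left_mem (h : IsJordanArc S x y) : x ∈ S := by
  obtain ⟨γ, -, rfl⟩ := h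
  exact ⟨0, γ.source⟩

theorem right_mem (h : IsJordanArc S x y) : y ∈ S := by
  obtain ⟨γ, -, rfl⟩ := h
  exact ⟨1, γ.target⟩

theorem isCompact (h : IsJordanArc S x y) : IsCompact S := by
  obtain ⟨γ, -, rfl⟩ := h
  exact isCompact_range γ.continuous

theorem symm (h : IsJordanArc S x y) : IsJordanArc S y x := by
  obtain ⟨γ, hγ, rfl⟩ := h
  refine ⟨γ.symm, fun s t hst => ?_, γ.symm_range⟩
  exact unitInterval.symm_bijective.injective (hγ hst)

theorem union (hS : IsJordanArc S x y) (hT : IsJordanArc T y z) (h : S ∩ T ⊆ {y}) :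
    IsJordanArc (S ∪ T) x z := by
  obtain ⟨γ, hγ, rfl⟩ := hS
  obtain ⟨δ, hδ, rfl⟩ := hT
  refine ⟨γ.trans δ, fun s t hst => ?_, γ.trans_range δ⟩
  have key : ∀ s t : unitInterval, γ s = δ t → s = 1 ∧ t = 0 := by
    intro s t hst
    have hy : γ s = y := h ⟨⟨s, rfl⟩, ⟨t, hst.symm⟩⟩
    exact ⟨hγ (hy.trans γ.target.symm), hδ ((hst.symm.trans hy).trans δ.source.symm)⟩
  rw [Path.trans_apply, Path.trans_apply] at hst
  apply Subtype.ext
  split_ifs at hst with h1 h2 h2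
  · have := congrArg Subtype.val (hγ hst)
    simp only at this
    linarith
  · have := congrArg Subtype.val (key _ _ hst).2
    simp only [Icc.coe_zero] at this
    linarith
  · have := congrArg Subtype.val (key _ _ hst.symm).2
    simp only [Icc.coe_zero] at this
    linarith
  · have := congrArg Subtype.val (hδ hst)
    simp only at this
    linarith

theorem exists_split (h : IsJordanArc S x y) (hp : p ∈ S) (hx : p ≠ x) (hy : p ≠ y) :
    ∃ A B : Set X, IsJordanArc A x p ∧ IsJordanArc B y p ∧ A ⊆ S ∧ B ⊆ S ∧ A ∩ B ⊆ {p} := by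
  obtain ⟨f, hf, hi, rfl, rfl, rfl⟩ := h.exists_parametrization
  obtain ⟨t, ht, rfl⟩ := hp
  have h0 : 0 < t := lt_of_le_of_ne ht.1 (by rintro rfl; exact hx rfl)
  have h1 : t < 1 := lt_of_le_of_ne ht.2 (by rintro rfl; exact hy rfl)
  have s0 : Icc 0 t ⊆ Icc 0 1 := Icc_subset_Icc_right ht.2
  have s1 : Icc t 1 ⊆ Icc 0 1 := Icc_subset_Icc_left ht.1
  refine ⟨_, _, of_injOn h0 (hf.mono s0) (hi.mono s0), (of_injOn h1 (hf.mono s1) (hi.mono s1)).symm,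
    image_mono s0, image_mono s1, ?_⟩
  rintro _ ⟨⟨a, ha, rfl⟩, ⟨b, hb, hab⟩⟩
  have hba : b = a := hi (s1 hb) (s0 ha) hab
  have hat : a = t := le_antisymm ha.2 (hba ▸ hb.1)
  rw [hat]
  rfl

/-- An arc that runs into a closed set can be cut off at its first hit; the hit is not an interior
point of the closed set. -/
theorem exists_first_hit (h : IsJordanArc S x y) {C : Set X} (hC : IsClosed C) (hx : x ∉ C)
    (hy : y ∈ C) :
    ∃ (A : Set X) (p : X), IsJordanArc A x p ∧ A ⊆ S ∧ A ∩ C = {p} ∧ p ∉ interior C := by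
  obtain ⟨f, hf, hi, rfl, rfl, rfl⟩ := h.exists_parametrization
  have hcl : IsCompact (Icc (0 : ℝ) 1 ∩ f ⁻¹' C) :=
    isCompact_Icc.of_isClosed_subset (hf.preimage_isClosed_of_isClosed isClosed_Icc hC)
      inter_subset_left
  obtain ⟨t, ⟨ht, htC⟩, hmin⟩ := hcl.exists_isLeast ⟨1, ⟨zero_le_one, le_rfl⟩, hy⟩
  have h0 : 0 < t := lt_of_le_of_ne ht.1 (by rintro rfl; exact hx htC)
  have s0 : Icc 0 t ⊆ Icc 0 1 := Icc_subset_Icc_right ht.2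
  refine ⟨_, _, of_injOn h0 (hf.mono s0) (hi.mono s0), image_mono s0, ?_, ?_⟩
  · ext q
    constructor
    · rintro ⟨⟨s, hs, rfl⟩, hsC⟩
      rw [le_antisymm hs.2 (hmin ⟨s0 hs, hsC⟩)]
      rfl
    · rintro rfl
      exact ⟨⟨t, ⟨h0.le, le_rfl⟩, rfl⟩, htC⟩
  · intro hint
    have hcont : ContinuousWithinAt f (Ico 0 t) t :=
      (hf t ht).mono (Ico_subset_Icc_self.trans s0)
    have hev := hcont.eventually (isOpen_interior.mem_nhds hint)
    have : (nhdsWithin t (Ico 0 t)).NeBot := by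
      rw [← mem_closure_iff_nhdsWithin_neBot, closure_Ico h0.ne]
      exact ⟨h0.le, le_rfl⟩
    obtain ⟨s, hs, hs'⟩ := (hev.and self_mem_nhdsWithin).exists
    have hsC : f s ∈ C := (interior_subset : interior C ⊆ C) hs
    exact absurd (hmin ⟨s0 (Ico_subset_Icc_self hs'), hsC⟩) (not_le.2 hs'.2)

end IsJordanArc

theorem isJordanArc_segment {E : Type*} [NormedAddCommGroup E] [NormedSpace ℝ E] {x y : E}
    (h : x ≠ y) : IsJordanArc (segment ℝ x y) x y := by
  have := IsJordanArc.of_injOn (f := AffineMap.lineMap (k := ℝ) x y) zero_lt_one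
    (by fun_prop) (AffineMap.lineMap_injective ℝ h).injOn
  rwa [← segment_eq_image_lineMap, AffineMap.lineMap_apply_zero, AffineMap.lineMap_apply_one]
    at this

/-! ### Chords of a circle in the plane -/

namespace SimpleGraph

namespace Plane

/-- The determinant of two plane vectors; it vanishes exactly when they are parallel. -/
def det (v w : Plane) : ℝ := v 0 * w 1 - v 1 * w 0

theorem exists_smul_of_det_eq_zero {v w : Plane} (hw : w ≠ 0) (h : det v w = 0) :
    ∃ t : ℝ, v = t • w := by
  unfold det at h
  by_cases h0 : w 0 = 0
  · have h1 : w 1 ≠ 0 := by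
      intro h1
      apply hw
      ext i
      fin_cases i <;> simpa
    refine ⟨v 1 / w 1, ?_⟩
    ext i
    fin_cases i
    · rw [h0, mul_zero, sub_zero] at h
      simpa [h0] using (mul_eq_zero.1 h).resolve_right h1
    · simp [h1]
  · refine ⟨v 0 / w 0, ?_⟩
    ext i
    fin_cases i
    · simp [h0]
    · simp
      field_simp
      linarith

/-- For independent `v` and `w`, the affine coordinates centred at `p` whose axes are the lines
through `p` in the directions `v` (where the second coordinate vanishes) and `w` (where the first
one does). -/
noncomputable def coordinates (p v w : Plane) (h : det v w ≠ 0) : Plane ≃ₜ ℝ × ℝ where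
  toFun z := (det (z - p) w, det (z - p) v)
  invFun c := p + (c.1 / det v w) • v - (c.2 / det v w) • w
  left_inv z := by
    ext i
    fin_cases i <;> simp <;> field_simp <;> simp [det] <;> ring
  right_inv c := by
    ext
    · simp [det] at h ⊢
      field_simp
      ring
    · simp [det] at h ⊢
      field_simp
      ring
  continuous_toFun := by
    unfold det
    fun_prop
  continuous_invFun := by fun_prop

theorem det_eq_zero_of_mem_segment {a b p q : Plane} (hp : p ∈ segment ℝ a b)
    (hq : q ∈ segment ℝ a b) : det (q - p) (b - a) = 0 := by
  rw [segment_eq_image_lineMap] at hp hq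
  obtain ⟨s, -, rfl⟩ := hp
  obtain ⟨t, -, rfl⟩ := hq
  simp [det, AffineMap.lineMap_apply]
  ring

theorem collinear_of_det_eq_zero {a b p q : Plane} (hab : a ≠ b) (hp : p ∈ segment ℝ a b)
    (h : det (q - p) (b - a) = 0) : Collinear ℝ {a, q, b} := by
  obtain ⟨t, ht⟩ := exists_smul_of_det_eq_zero (sub_ne_zero.2 hab.symm) h
  rw [segment_eq_image_lineMap] at hp
  obtain ⟨s, -, rfl⟩ := hp
  rw [collinear_iff_of_mem (p₀ := a) (by simp)]
  refine ⟨b - a, ?_⟩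
  rintro z (rfl | rfl | rfl)
  · exact ⟨0, by simp⟩
  · refine ⟨t + s, ?_⟩
    rw [sub_eq_iff_eq_add] at ht
    rw [ht, AffineMap.lineMap_apply]
    simp [add_smul, add_assoc]
  · exact ⟨1, by simp⟩

section Chords

variable {o a b c d p q : Plane} {r : ℝ}

theorem mem_segment_of_det_eq_zero (ha : a ∈ Metric.sphere o r) (hb : b ∈ Metric.sphere o r) (hab : a ≠ b)
    (hp : p ∈ segment ℝ a b) (hq : q ∈ Metric.closedBall o r) (h : det (q - p) (b - a) = 0) :
    q ∈ segment ℝ a b :=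
  mem_segment_iff_wbtw.2 <| (collinear_of_det_eq_zero hab hp h).wbtw_of_dist_eq_of_dist_le
    ha hq hb hab

theorem eq_or_eq_of_mem_segment_of_mem_sphere (ha : a ∈ Metric.sphere o r) (hb : b ∈ Metric.sphere o r)
    (hab : a ≠ b) (hp : p ∈ segment ℝ a b) (hpr : p ∈ Metric.sphere o r) : p = a ∨ p = b := by
  by_contra! hne
  have := openSegment_subset_ball_of_ne (Metric.sphere_subset_closedBall ha) (Metric.sphere_subset_closedBall hb)
    hab (mem_openSegment_of_ne_left_right hne.1.symm hne.2.symm hp)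
  rw [Metric.mem_ball, Metric.mem_sphere.1 hpr] at this
  exact lt_irrefl _ this

/-- Two chords of a circle without a common end that meet are not parallel: otherwise one line
would meet the circle in more than two points. -/
theorem det_ne_zero_of_chords (ha : a ∈ Metric.sphere o r) (hb : b ∈ Metric.sphere o r) (hc : c ∈ Metric.sphere o r)
    (hab : a ≠ b) (hca : c ≠ a) (hcb : c ≠ b) (hp : p ∈ segment ℝ a b) (hp' : p ∈ segment ℝ c d) :
    det (b - a) (d - c) ≠ 0 := by
  intro h
  have hcd := det_eq_zero_of_mem_segment hp' (left_mem_segment ℝ c d)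
  have key : det (c - p) (b - a) = 0 := by
    obtain rfl | hne := eq_or_ne c d
    · rw [segment_same, mem_singleton_iff] at hp'
      simp [hp', det]
    · obtain ⟨t, ht⟩ := exists_smul_of_det_eq_zero (sub_ne_zero.2 hne.symm) hcd
      obtain ⟨s, hs⟩ := exists_smul_of_det_eq_zero (sub_ne_zero.2 hne.symm) h
      rw [ht, hs]
      simp [det]
      ring
  have hmem := mem_segment_of_det_eq_zero ha hb hab hp (Metric.sphere_subset_closedBall hc) key
  exact (eq_or_eq_of_mem_segment_of_mem_sphere ha hb hab hmem hc).elim hca hcb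

theorem eq_of_mem_chords (h : det (b - a) (d - c) ≠ 0) (hp : p ∈ segment ℝ a b)
    (hp' : p ∈ segment ℝ c d) (hq : q ∈ segment ℝ a b) (hq' : q ∈ segment ℝ c d) : p = q := by
  apply (coordinates q (b - a) (d - c) h).injective
  refine Prod.ext ?_ ?_
  · exact (det_eq_zero_of_mem_segment hq' hp').trans (by simp [coordinates, det])
  · exact (det_eq_zero_of_mem_segment hq hp).trans (by simp [coordinates, det])

/-- If, inside an open disc, `A` and `B` are two chords of the bounding circle without a common
end, then they cross properly wherever they meet in the disc. -/
theorem crossProperlyAt_of_chords {A B : Set Plane} (ha : a ∈ Metric.sphere o r) (hb : b ∈ Metric.sphere o r)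
    (hc : c ∈ Metric.sphere o r) (hd : d ∈ Metric.sphere o r) (hab : a ≠ b) (hcd : c ≠ d) (hca : c ≠ a)
    (hcb : c ≠ b) (hA : ∀ q ∈ Metric.ball o r, q ∈ A ↔ q ∈ segment ℝ a b)
    (hB : ∀ q ∈ Metric.ball o r, q ∈ B ↔ q ∈ segment ℝ c d) (hp : p ∈ Metric.ball o r) (hpA : p ∈ A)
    (hpB : p ∈ B) : CrossProperlyAt A B p := by
  rw [hA p hp] at hpA
  rw [hB p hp] at hpB
  have h := det_ne_zero_of_chords ha hb hc hab hca hcb hpA hpB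
  refine ⟨(coordinates p (b - a) (d - c) h).toOpenPartialHomeomorph.restrOpen (Metric.ball o r)
    Metric.isOpen_ball, by simpa using hp, by simp [coordinates, det], ?_, ?_⟩
  · intro q hq
    have hq : q ∈ Metric.ball o r := by simpa using hq
    rw [hA q hq]
    exact ⟨fun h' => det_eq_zero_of_mem_segment hpA h',
      fun h' => mem_segment_of_det_eq_zero ha hb hab hpA (Metric.ball_subset_closedBall hq) h'⟩
  · intro q hq
    have hq : q ∈ Metric.ball o r := by simpa using hq
    rw [hB q hq]
    exact ⟨fun h' => det_eq_zero_of_mem_segment hpB h',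
      fun h' => mem_segment_of_det_eq_zero hc hd hcd hpB (Metric.ball_subset_closedBall hq) h'⟩

end Chords

end Plane

end SimpleGraph

/-! ### Turning crossings into vertices -/

namespace SimpleGraph

universe u

variable {V : Type u} {G : SimpleGraph V}

namespace Drawing

variable (Γ : Drawing G)

theorem isJordanArc {e : G.edgeSet} {u v : V} (h : (e : Sym2 V) = s(u, v)) :
    IsJordanArc (Γ.arc e) (Γ.pos u) (Γ.pos v) := by
  obtain ⟨e, he⟩ := e
  subst h
  exact Γ.arc_isJordanArc u v he

theorem isCompact_arc (e : G.edgeSet) : IsCompact (Γ.arc e) := by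
  obtain ⟨⟨u, v⟩, he⟩ := e
  exact (Γ.isJordanArc (e := ⟨s(u, v), he⟩) rfl).isCompact

variable {Γ} in
theorem IsCrossing.symm {e f : G.edgeSet} {p : Plane} (h : Γ.IsCrossing e f p) :
    Γ.IsCrossing f e p :=
  ⟨h.1.symm, h.2.2.1, h.2.1, h.2.2.2⟩

/-- A non-vertex point of an edge splits the edge into two half-edges, indexed here by the
end-vertices. -/
theorem exists_halves {e : G.edgeSet} {p : Plane} (hp : p ∈ Γ.arc e) (hpos : p ∉ range Γ.pos) :
    ∃ T : V → Set Plane, ∀ u ∈ (e : Sym2 V), IsJordanArc (T u) (Γ.pos u) p ∧ T u ⊆ Γ.arc e ∧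
      ∀ v ∈ (e : Sym2 V), u ≠ v → T u ∩ T v ⊆ {p} := by
  classical
  obtain ⟨⟨a, b⟩, he⟩ := e
  obtain ⟨A, B, hA, hB, hAS, hBS, hAB⟩ := (Γ.isJordanArc (e := ⟨s(a, b), he⟩) rfl).exists_split hp
    (fun h => hpos ⟨a, h.symm⟩) (fun h => hpos ⟨b, h.symm⟩)
  have hab : b ≠ a := (G.ne_of_adj he).symm
  refine ⟨fun v => if v = a then A else B, fun u hu => ?_⟩
  obtain rfl | rfl := Sym2.mem_iff.1 hu
  · refine ⟨by simpa using hA, by simpa using hAS, fun v hv huv => ?_⟩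
    simpa [huv.symm] using hAB
  · refine ⟨by simpa [hab] using hB, by simpa [hab] using hBS, fun v hv huv => ?_⟩
    obtain rfl | rfl := Sym2.mem_iff.1 hv
    · simpa [hab, inter_comm] using hAB
    · exact absurd rfl huv

/-- A crossing of two independent edges splits both of them into half-edges; since the four
end-vertices are distinct, the half-edges can be indexed by them. -/
theorem exists_halves_of_isCrossing {e f : G.edgeSet} {p : Plane} (h : Γ.IsCrossing e f p)
    (hef : EdgesIndependent (e : Sym2 V) f) :
    ∃ T : V → Set Plane, ∀ g : G.edgeSet, (g : Sym2 V) ∈ s((e : Sym2 V), (f : Sym2 V)) →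
      ∀ u ∈ (g : Sym2 V), IsJordanArc (T u) (Γ.pos u) p ∧ T u ⊆ Γ.arc g ∧
        ∀ v ∈ (g : Sym2 V), u ≠ v → T u ∩ T v ⊆ {p} := by
  classical
  obtain ⟨A, hA⟩ := Γ.exists_halves h.2.1 h.2.2.2
  obtain ⟨B, hB⟩ := Γ.exists_halves h.2.2.1 h.2.2.2
  refine ⟨fun v => if v ∈ (e : Sym2 V) then A v else B v, fun g hg u hu => ?_⟩
  obtain hg | hg := Sym2.mem_iff.1 hg
  · obtain rfl := Subtype.ext hg
    refine ⟨by simpa [hu] using (hA u hu).1, by simpa [hu] using (hA u hu).2.1, fun v hv huv => ?_⟩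
    simpa [hu, hv] using (hA u hu).2.2 v hv huv
  · obtain rfl := Subtype.ext hg
    have hn : ∀ v ∈ (g : Sym2 V), v ∉ (e : Sym2 V) := fun v hv he => hef v he hv
    refine ⟨by simpa [hn u hu] using (hB u hu).1, by simpa [hn u hu] using (hB u hu).2.1,
      fun v hv huv => ?_⟩
    simpa [hn u hu, hn v hv] using (hB u hu).2.2 v hv huv

/-- A point common to two edges of a drawing is a vertex or a crossing, so a drawing without such
points beyond the vertices makes the graph planar. -/
theorem isPlanar_of_arcs {W : Type u} {H : SimpleGraph W} (pos : W → Plane)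
    (arc : Sym2 W → Set Plane) (hpos : Function.Injective pos)
    (harc : ∀ u v, H.Adj u v → IsJordanArc (arc s(u, v)) (pos u) (pos v))
    (hmem : ∀ e ∈ H.edgeSet, ∀ w, pos w ∈ arc e → w ∈ e)
    (hdisj : ∀ e ∈ H.edgeSet, ∀ f ∈ H.edgeSet, e ≠ f → arc e ∩ arc f ⊆ range pos) :
    H.IsPlanar := by
  have key : ∀ (e f : H.edgeSet) (p : Plane), e ≠ f → p ∈ arc e → p ∈ arc f → p ∈ range pos :=
    fun e f p hef he hf => hdisj e e.2 f f.2 (fun h => hef (Subtype.ext h)) ⟨he, hf⟩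
  let Δ : Drawing H :=
    { pos := pos
      arc := fun e => arc e
      pos_injective := hpos
      arc_isJordanArc := harc
      mem_of_pos_mem_arc := fun e w hw => hmem e e.2 w hw
      crossProperly := fun e f p hef he hf hp => absurd (key e f p hef he hf) hp
      no_three := fun e f g p hef _ _ he hf _ => key e f p hef he hf }
  have free : Δ.IsCrossingFree := fun e f p h => h.2.2.2 (key e f p h.1 h.2.1 h.2.2.1)
  exact ⟨Δ, ⟨fun e f p h => absurd h (free e f p), fun e f p _ h => absurd h (free e f p)⟩, free⟩

variable {k : ℕ} {σ : Fin k ≃ G.independentPairs} {y : Fin k → Fin 2}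

/-- Turning the crossings of a simple drawing into vertices gives a crossing-free drawing. -/
theorem dummyGraph_isPlanar (hs : Γ.IsSimple)
    (hy : ∀ i, y i = 1 ↔ ∃ (e f : G.edgeSet) (p : Plane),
      (σ i : Sym2 (Sym2 V)) = s((e : Sym2 V), (f : Sym2 V)) ∧ Γ.IsCrossing e f p)
    (h1 : G.CrossedAtMostOnce σ y) : (G.dummyGraph σ y).IsPlanar := by
  choose ce cf c hσ hc using fun d : {i // y i = 1} => (hy d).1 d.2
  choose T hT using fun d => Γ.exists_halves_of_isCrossing (hc d) (hs.1 _ _ _ (hc d))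
  have hT : ∀ (d : {i // y i = 1}) (g : G.edgeSet), (g : Sym2 V) ∈ (σ d : Sym2 (Sym2 V)) →
      ∀ u ∈ (g : Sym2 V), IsJordanArc (T d u) (Γ.pos u) (c d) ∧ T d u ⊆ Γ.arc g ∧
        ∀ v ∈ (g : Sym2 V), u ≠ v → T d u ∩ T d v ⊆ {c d} :=
    fun d g hg => hT d g (hσ d ▸ hg)
  have hedge : ∀ d : {i // y i = 1}, ∀ e ∈ (σ d : Sym2 (Sym2 V)), e ∈ G.edgeSet := by
    intro d e he
    rw [hσ d] at he
    obtain rfl | rfl := Sym2.mem_iff.1 he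
    exacts [(ce d).2, (cf d).2]
  -- no third edge passes through a crossing, so the crossing point determines its pair
  have hmemσ : ∀ (d : {i // y i = 1}) (e : G.edgeSet), c d ∈ Γ.arc e → (e : Sym2 V) ∈ (σ d : Sym2 (Sym2 V)) := by
    intro d e he
    rw [hσ d]
    by_contra hne
    rw [Sym2.mem_iff, not_or] at hne
    exact (hc d).2.2.2 (Γ.no_three e (ce d) (cf d) (c d) (fun h => hne.1 (congrArg _ h))
      (fun h => hne.2 (congrArg _ h)) (hc d).1 he (hc d).2.1 (hc d).2.2.1)
  -- two edges meet only in vertices and in the crossing of their own pair, which is chosen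
  have hmeet : ∀ (e f : G.edgeSet) (p : Plane), e ≠ f → p ∈ Γ.arc e → p ∈ Γ.arc f →
      p ∈ range Γ.pos ∨ ∃ d, p = c d := by
    intro e f p hef he hf
    by_cases hp : p ∈ range Γ.pos
    · exact Or.inl hp
    have hcr : Γ.IsCrossing e f p := ⟨hef, he, hf, hp⟩
    obtain ⟨i, hi⟩ := σ.surjective ⟨s((e : Sym2 V), (f : Sym2 V)), e, e.2, f, f.2,
      hs.1 _ _ _ hcr, rfl⟩
    have hi : (σ i : Sym2 (Sym2 V)) = s((e : Sym2 V), (f : Sym2 V)) := congrArg Subtype.val hi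
    have hyi : y i = 1 := (hy i).2 ⟨e, f, p, hi, hcr⟩
    refine Or.inr ⟨⟨i, hyi⟩, ?_⟩
    have := (hσ ⟨i, hyi⟩).symm.trans hi
    obtain ⟨h, h'⟩ | ⟨h, h'⟩ := Sym2.eq_iff.1 this
    · have hc' := hc ⟨i, hyi⟩
      rw [Subtype.ext h, Subtype.ext h'] at hc'
      exact hs.2 _ _ _ _ hcr hc'
    · have hc' := hc ⟨i, hyi⟩
      rw [Subtype.ext h, Subtype.ext h'] at hc'
      exact hs.2 _ _ _ _ hcr hc'.symm
  -- an edge in no chosen pair keeps its arc, an edge at a dummy vertex gets its half-edge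
  let arc : Sym2 (V ⊕ {i // y i = 1}) → Set Plane := fun E =>
    {p | (∃ e : G.edgeSet, E = Sym2.map Sum.inl (e : Sym2 V) ∧ p ∈ Γ.arc e) ∨
      ∃ u d, E = s(Sum.inl u, Sum.inr d) ∧ p ∈ T d u}
  have arc_kept : ∀ e : G.edgeSet, arc (Sym2.map Sum.inl (e : Sym2 V)) = Γ.arc e := by
    intro e
    ext p
    constructor
    · rintro (⟨f, hf, hp⟩ | ⟨u, d, h, -⟩)
      · rwa [Subtype.ext (Sym2.map.injective Sum.inl_injective hf)]
      · have : (Sum.inr d : V ⊕ {i // y i = 1}) ∈ Sym2.map Sum.inl (e : Sym2 V) := by simp [h]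
        simp at this
    · exact fun hp => Or.inl ⟨e, rfl, hp⟩
  have arc_half : ∀ u d, arc s(Sum.inl u, Sum.inr d) = T d u := by
    intro u d
    ext p
    constructor
    · rintro (⟨f, hf, hp⟩ | ⟨v, d', h, hp⟩)
      · have : (Sum.inr d : V ⊕ {i // y i = 1}) ∈ Sym2.map Sum.inl (f : Sym2 V) := by simp [← hf]
        simp at this
      · simp at h
        rwa [h.1, h.2]
    · exact fun hp => Or.inr ⟨u, d, rfl, hp⟩
  have hcases : ∀ E ∈ (G.dummyGraph σ y).edgeSet,
      (∃ e : G.edgeSet, E = Sym2.map Sum.inl (e : Sym2 V) ∧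
        ∀ i, y i = 1 → (e : Sym2 V) ∉ (σ i : Sym2 (Sym2 V))) ∨
      ∃ u d, ∃ e : G.edgeSet, E = s(Sum.inl u, Sum.inr d) ∧
        (e : Sym2 V) ∈ (σ d : Sym2 (Sym2 V)) ∧ u ∈ (e : Sym2 V) := by
    rintro ⟨u | d, v | d'⟩ h
    · exact Or.inl ⟨⟨s(u, v), h.1⟩, rfl, h.2⟩
    · obtain ⟨e, he, hu⟩ := h
      exact Or.inr ⟨u, d', ⟨e, hedge _ e he⟩, rfl, he, hu⟩
    · obtain ⟨e, he, hu⟩ := h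
      exact Or.inr ⟨v, d, ⟨e, hedge _ e he⟩, Sym2.eq_swap, he, hu⟩
    · exact h.elim
  have hpairs : ∀ (d d' : {i // y i = 1}) (e : G.edgeSet), (e : Sym2 V) ∈ (σ d : Sym2 (Sym2 V)) →
      (e : Sym2 V) ∈ (σ d' : Sym2 (Sym2 V)) → d = d' :=
    fun d d' e h h' => Subtype.ext (h1 e e.2 d d' d.2 d'.2 h h')
  have hrange : ∀ p, (p ∈ range Γ.pos ∨ ∃ d, p = c d) → p ∈ range (Sum.elim Γ.pos c) := by
    rintro p (⟨v, rfl⟩ | ⟨d, rfl⟩)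
    exacts [⟨Sum.inl v, rfl⟩, ⟨Sum.inr d, rfl⟩]
  refine isPlanar_of_arcs (Sum.elim Γ.pos c) arc ?_ ?_ ?_ ?_
  · refine Γ.pos_injective.sumElim ?_ fun v d h => (hc d).2.2.2 ⟨v, h⟩
    intro d d' h
    exact hpairs d d' (ce d) (by simp [hσ]) (hmemσ d' _ (h ▸ (hc d).2.1))
  · rintro (u | d) (v | d') h
    · exact (arc_kept ⟨s(u, v), h.1⟩).symm ▸ Γ.isJordanArc rfl
    · obtain ⟨e, he, hu⟩ := h
      rw [arc_half]
      exact (hT d' ⟨e, hedge _ e he⟩ he u hu).1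
    · obtain ⟨e, he, hu⟩ := h
      rw [Sym2.eq_swap, arc_half]
      exact (hT d ⟨e, hedge _ e he⟩ he v hu).1.symm
    · exact h.elim
  · intro E hE w hw
    obtain ⟨e, rfl, hk⟩ | ⟨u, d, e, rfl, he, hu⟩ := hcases E hE
    · rw [arc_kept] at hw
      rcases w with w | d'
      · simpa using Γ.mem_of_pos_mem_arc e w hw
      · exact absurd (hmemσ d' e hw) (hk _ d'.2)
    · rw [arc_half] at hw
      have hw' := (hT d e he u hu).2.1 hw
      rcases w with w | d'
      · have hwe := Γ.mem_of_pos_mem_arc e w hw'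
        by_contra hne
        have huw : u ≠ w := by
          rintro rfl
          simp at hne
        have := (hT d e he u hu).2.2 w hwe huw ⟨hw, (hT d e he w hwe).1.left_mem⟩
        exact (hc d).2.2.2 ⟨w, this⟩
      · rw [hpairs d d' e he (hmemσ d' e hw')]
        simp
  · intro E hE F hF hEF p hp
    apply hrange
    obtain ⟨e, rfl, hk⟩ | ⟨u, d, e, rfl, he, hu⟩ := hcases E hE <;>
    obtain ⟨f, rfl, hk'⟩ | ⟨v, d', f, rfl, hf, hv⟩ := hcases F hF
    · rw [arc_kept, arc_kept] at hp
      exact hmeet e f p (by rintro rfl; exact hEF rfl) hp.1 hp.2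
    · rw [arc_kept, arc_half] at hp
      exact hmeet e f p (by rintro rfl; exact hk _ d'.2 hf) hp.1 ((hT d' f hf v hv).2.1 hp.2)
    · rw [arc_kept, arc_half] at hp
      exact hmeet e f p (by rintro rfl; exact hk' _ d.2 he) ((hT d e he u hu).2.1 hp.1) hp.2
    · rw [arc_half, arc_half] at hp
      by_cases hef : e = f
      · subst hef
        obtain rfl := hpairs d d' e he hf
        exact Or.inr ⟨d, (hT d e he u hu).2.2 v hv (by rintro rfl; exact hEF rfl) hp⟩
      · exact hmeet e f p hef ((hT d e he u hu).2.1 hp.1) ((hT d' f hf v hv).2.1 hp.2)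

end Drawing

/-- The pairs to choose are those that cross in a given drawing. -/
theorem IsOnePlanar.exists_isTrueSolution (h : G.IsOnePlanar) {k : ℕ}
    (σ : Fin k ≃ G.independentPairs) : ∃ y : Fin k → Fin 2, G.IsTrueSolution σ y := by
  classical
  obtain ⟨Γ, hs, hone⟩ := h
  obtain ⟨y, hy⟩ : ∃ y : Fin k → Fin 2, ∀ i, y i = 1 ↔ ∃ (e f : G.edgeSet) (p : Plane),
      (σ i : Sym2 (Sym2 V)) = s((e : Sym2 V), (f : Sym2 V)) ∧ Γ.IsCrossing e f p :=
    ⟨fun i => if ∃ (e f : G.edgeSet) (p : Plane),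
      (σ i : Sym2 (Sym2 V)) = s((e : Sym2 V), (f : Sym2 V)) ∧ Γ.IsCrossing e f p then 1 else 0,
      fun i => by rw [ite_eq_left_iff, imp_iff_not (by decide), not_not]⟩
  have hother : ∀ (e : G.edgeSet) (i : Fin k), (∃ (e f : G.edgeSet) (p : Plane),
      (σ i : Sym2 (Sym2 V)) = s((e : Sym2 V), (f : Sym2 V)) ∧ Γ.IsCrossing e f p) →
      (e : Sym2 V) ∈ (σ i : Sym2 (Sym2 V)) → ∃ (f : G.edgeSet) (p : Plane),
      (σ i : Sym2 (Sym2 V)) = s((e : Sym2 V), (f : Sym2 V)) ∧ Γ.IsCrossing e f p := by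
    rintro e i ⟨a, b, p, hi, hc⟩ he
    rw [hi] at he
    obtain h | h := Sym2.mem_iff.1 he
    · obtain rfl := Subtype.ext h
      exact ⟨b, p, hi, hc⟩
    · obtain rfl := Subtype.ext h
      exact ⟨a, p, hi.trans Sym2.eq_swap, hc.symm⟩
  have h1 : G.CrossedAtMostOnce σ y := by
    intro e he i j hi hj hei hej
    obtain ⟨f, p, hi, hc⟩ := hother ⟨e, he⟩ i ((hy i).1 hi) hei
    obtain ⟨g, q, hj, hc'⟩ := hother ⟨e, he⟩ j ((hy j).1 hj) hej
    have : (f, p) = (g, q) := hone ⟨e, he⟩ hc hc'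
    apply σ.injective
    rw [Subtype.ext_iff, hi, hj, show f = g from congrArg Prod.fst this]
  exact ⟨_, h1, Γ.dummyGraph_isPlanar hs hy h1⟩

end SimpleGraph

/-! ### Turning dummy vertices into crossings -/

namespace SimpleGraph

universe u

namespace Drawing

variable {W : Type u} {H : SimpleGraph W} (Δ : Drawing H)

/-- In a drawing of a finite graph, one radius serves for pairwise disjoint discs around all
vertices, each of which meets only the arcs of the edges at its centre. -/
theorem exists_radius [Finite W] : ∃ r : ℝ, 0 < r ∧
    (∀ (w : W) (e : H.edgeSet), w ∉ (e : Sym2 W) →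
      Disjoint (Metric.closedBall (Δ.pos w) r) (Δ.arc e)) ∧
    ∀ w w' : W, w ≠ w' →
      Disjoint (Metric.closedBall (Δ.pos w) r) (Metric.closedBall (Δ.pos w') r) := by
  have hA : ∀ᶠ r in nhdsWithin (0 : ℝ) (Ioi 0), ∀ (w : W) (e : H.edgeSet), w ∉ (e : Sym2 W) →
      Disjoint (Metric.closedBall (Δ.pos w) r) (Δ.arc e) := by
    refine Filter.eventually_all.2 fun w => Filter.eventually_all.2 fun e => ?_
    by_cases hw : w ∈ (e : Sym2 W)
    · exact Filter.Eventually.of_forall fun r h => absurd hw h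
    · have hmem : (Δ.arc e)ᶜ ∈ nhds (Δ.pos w) :=
        (Δ.isCompact_arc e).isClosed.isOpen_compl.mem_nhds
          fun h => hw (Δ.mem_of_pos_mem_arc e w h)
      filter_upwards [nhdsWithin_le_nhds (eventually_closedBall_subset hmem)] with r hr _
      exact subset_compl_iff_disjoint_right.1 hr
  have hB : ∀ᶠ r in nhdsWithin (0 : ℝ) (Ioi 0), ∀ w w' : W, w ≠ w' →
      Disjoint (Metric.closedBall (Δ.pos w) r) (Metric.closedBall (Δ.pos w') r) := by
    refine Filter.eventually_all.2 fun w => Filter.eventually_all.2 fun w' => ?_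
    by_cases hw : w = w'
    · exact Filter.Eventually.of_forall fun r h => absurd hw h
    · have hd : 0 < Dist.dist (Δ.pos w) (Δ.pos w') := dist_pos.2 (Δ.pos_injective.ne hw)
      filter_upwards [nhdsWithin_le_nhds (eventually_lt_nhds (half_pos hd))] with r hr _
      exact Metric.closedBall_disjoint_closedBall (by linarith)
  obtain ⟨r, ⟨h, h'⟩, hr⟩ := ((hA.and hB).and self_mem_nhdsWithin).exists
  exact ⟨r, hr, h, h'⟩

/-- The part of an edge outside a small disc around one of its end-vertices `w`: an arc from the
other end-vertex that meets the disc in a single point of the bounding circle. -/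
theorem exists_arc_to_sphere {v w : W} (h : H.Adj v w) {r : ℝ} (hr : 0 < r)
    (hv : Δ.pos v ∉ Metric.closedBall (Δ.pos w) r) :
    ∃ (O : Set Plane) (x : Plane), IsJordanArc O (Δ.pos v) x ∧ O ⊆ Δ.arc ⟨s(v, w), h⟩ ∧
      O ∩ Metric.closedBall (Δ.pos w) r = {x} ∧ x ∈ Metric.sphere (Δ.pos w) r := by
  obtain ⟨O, x, hO, hsub, hx, hint⟩ :=
    (Δ.isJordanArc (e := ⟨s(v, w), h⟩) rfl).exists_first_hit Metric.isClosed_closedBall hv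
      (Metric.mem_closedBall_self hr.le)
  have hxC : x ∈ Metric.closedBall (Δ.pos w) r :=
    (hx.symm.subset (mem_singleton x)).2
  refine ⟨O, x, hO, hsub, hx, le_antisymm hxC (not_lt.1 fun hlt => hint ?_)⟩
  exact Metric.ball_subset_interior_closedBall hlt

end Drawing

variable {V : Type u} {G : SimpleGraph V} {k : ℕ} {σ : Fin k ≃ G.independentPairs}
  {y : Fin k → Fin 2}

theorem independent_of_mem_of_mem {P : G.independentPairs} {e f : Sym2 V}
    (he : e ∈ (P : Sym2 (Sym2 V))) (hf : f ∈ (P : Sym2 (Sym2 V))) (hef : e ≠ f) :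
    EdgesIndependent e f := by
  obtain ⟨P, a, ha, b, hb, hab, rfl⟩ := P
  have hba : EdgesIndependent b a := fun v hv hv' => hab v hv' hv
  simp only [Sym2.mem_iff] at he hf
  rcases he with rfl | rfl <;> rcases hf with rfl | rfl
  exacts [absurd rfl hef, hab, hba, absurd rfl hef]

theorem mem_edgeSet_of_mem {P : G.independentPairs} {e : Sym2 V}
    (he : e ∈ (P : Sym2 (Sym2 V))) : e ∈ G.edgeSet := by
  obtain ⟨P, a, ha, b, hb, hab, rfl⟩ := P
  simp only [Sym2.mem_iff] at he
  rcases he with rfl | rfl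
  exacts [ha, hb]

theorem map_inl_mem_edgeSet_dummyGraph {e : Sym2 V} :
    Sym2.map Sum.inl e ∈ (G.dummyGraph σ y).edgeSet ↔
      e ∈ G.edgeSet ∧ ∀ i, y i = 1 → e ∉ (σ i : Sym2 (Sym2 V)) := by
  induction e with
  | _ a b => exact Iff.rfl

/-- In a crossing-free drawing of the dummy graph, every small disc around a dummy vertex can be
emptied and the two edges of its pair reconnected through the disc by chords. The chords of the two
edges are either disjoint or cross properly in one point, whatever the cyclic order in which the
four arcs arrive. -/
theorem IsTrueSolution.isOnePlanar [Finite V] (h : G.IsTrueSolution σ y) : G.IsOnePlanar := by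
  obtain ⟨h1, Δ, -, free⟩ := h
  obtain ⟨r, hr, harc, hball⟩ := Δ.exists_radius
  have hpos : ∀ w w', w ≠ w' → Δ.pos w ∉ Metric.closedBall (Δ.pos w') r := fun w w' hw hmem =>
    Set.disjoint_left.1 (hball w w' hw) (Metric.mem_closedBall_self hr.le) hmem
  have hmeet : ∀ (E F : (G.dummyGraph σ y).edgeSet) (p : Plane), E ≠ F → p ∈ Δ.arc E →
      p ∈ Δ.arc F → ∃ w, Δ.pos w = p ∧ w ∈ (E : Sym2 _) ∧ w ∈ (F : Sym2 _) := by
    intro E F p hEF hE hF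
    by_contra hp
    refine free E F p ⟨hEF, hE, hF, ?_⟩
    rintro ⟨w, rfl⟩
    exact hp ⟨w, rfl, Δ.mem_of_pos_mem_arc E w hE, Δ.mem_of_pos_mem_arc F w hF⟩
  have hpairs : ∀ (d d' : {i // y i = 1}) (e : Sym2 V), e ∈ (σ d : Sym2 (Sym2 V)) →
      e ∈ (σ d' : Sym2 (Sym2 V)) → d = d' :=
    fun d d' e he he' => Subtype.ext (h1 e (mem_edgeSet_of_mem he) d d' d.2 d'.2 he he')
  -- `O d u` is the part of the arc from `u` to the dummy vertex `d` outside the disc around `d`,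
  -- and `x d u` is the point where it reaches the disc
  have hex : ∀ (d : {i // y i = 1}) (u : V), ∃ (O : Set Plane) (x : Plane),
      ∀ h : (G.dummyGraph σ y).Adj (Sum.inl u) (Sum.inr d),
      IsJordanArc O (Δ.pos (Sum.inl u)) x ∧ O ⊆ Δ.arc ⟨s(Sum.inl u, Sum.inr d), h⟩ ∧
      O ∩ Metric.closedBall (Δ.pos (Sum.inr d)) r = {x} ∧
      x ∈ Metric.sphere (Δ.pos (Sum.inr d)) r := by
    intro d u
    by_cases h : (G.dummyGraph σ y).Adj (Sum.inl u) (Sum.inr d)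
    · obtain ⟨O, x, hO⟩ := Δ.exists_arc_to_sphere h hr (hpos _ _ (by simp))
      exact ⟨O, x, fun _ => hO⟩
    · exact ⟨∅, 0, fun h' => absurd h' h⟩
  choose O x hO using hex
  have hadj : ∀ (d : {i // y i = 1}) (e : Sym2 V), e ∈ (σ d : Sym2 (Sym2 V)) → ∀ u ∈ e,
      (G.dummyGraph σ y).Adj (Sum.inl u) (Sum.inr d) := fun d e he u hu => ⟨e, he, hu⟩
  have hOball : ∀ d u p, (G.dummyGraph σ y).Adj (Sum.inl u) (Sum.inr d) → p ∈ O d u →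
      p ∈ Metric.closedBall (Δ.pos (Sum.inr d)) r → p = x d u :=
    fun d u p h hp hp' => (hO d u h).2.2.1.subset ⟨hp, hp'⟩
  have hOdummy : ∀ d u, (G.dummyGraph σ y).Adj (Sum.inl u) (Sum.inr d) →
      Δ.pos (Sum.inr d) ∉ O d u := by
    intro d u h hp
    have := (hO d u h).2.2.2
    rw [← hOball d u _ h hp (Metric.mem_closedBall_self hr.le), Metric.mem_sphere, _root_.dist_self]
      at this
    exact hr.ne this
  have hOmeet : ∀ d d' u u' p, (G.dummyGraph σ y).Adj (Sum.inl u) (Sum.inr d) →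
      (G.dummyGraph σ y).Adj (Sum.inl u') (Sum.inr d') → p ∈ O d u → p ∈ O d' u' →
      (d = d' ∧ u = u') ∨ (u = u' ∧ p = Δ.pos (Sum.inl u)) := by
    intro d d' u u' p h h' hp hp'
    by_cases hE : s((Sum.inl u : V ⊕ {i // y i = 1}), Sum.inr d) = s(Sum.inl u', Sum.inr d')
    · simp at hE
      exact Or.inl ⟨hE.2, hE.1⟩
    · obtain ⟨w, rfl, hw, hw'⟩ := hmeet ⟨_, h⟩ ⟨_, h'⟩ p (fun h => hE (congrArg Subtype.val h))
        ((hO d u h).2.1 hp) ((hO d' u' h').2.1 hp')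
      rcases w with w | w
      · simp at hw hw'
        exact Or.inr ⟨hw.symm.trans hw', by rw [hw]⟩
      · simp at hw hw'
        subst hw
        exact absurd hp (hOdummy _ _ h)
  have hOdisj : ∀ d u u', (G.dummyGraph σ y).Adj (Sum.inl u) (Sum.inr d) →
      (G.dummyGraph σ y).Adj (Sum.inl u') (Sum.inr d) → u ≠ u' → Disjoint (O d u) (O d u') := by
    intro d u u' h h' hne
    rw [Set.disjoint_left]
    intro p hp hp'
    rcases hOmeet d d u u' p h h' hp hp' with h | h
    exacts [hne h.2, hne h.1]
  have hxne : ∀ d u u', (G.dummyGraph σ y).Adj (Sum.inl u) (Sum.inr d) →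
      (G.dummyGraph σ y).Adj (Sum.inl u') (Sum.inr d) → u ≠ u' → x d u ≠ x d u' := by
    intro d u u' h h' hne heq
    exact Set.disjoint_left.1 (hOdisj d u u' h h' hne) (hO d u h).1.right_mem
      (heq ▸ (hO d u' h').1.right_mem)
  -- the straight segment inside the disc around `d` that replaces the two arcs of `e` there
  let chord : {i // y i = 1} → Sym2 V → Set Plane := fun d e =>
    {p | ∃ a b, e = s(a, b) ∧ p ∈ segment ℝ (x d a) (x d b)}
  have chord_mk : ∀ d a b, chord d s(a, b) = segment ℝ (x d a) (x d b) := by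
    intro d a b
    ext p
    constructor
    · rintro ⟨a', b', h, hp⟩
      obtain ⟨rfl, rfl⟩ | ⟨rfl, rfl⟩ := Sym2.eq_iff.1 h
      · exact hp
      · rwa [segment_symm]
    · exact fun hp => ⟨a, b, rfl, hp⟩
  have chord_ball : ∀ (d : {i // y i = 1}) (e : Sym2 V), e ∈ (σ d : Sym2 (Sym2 V)) →
      chord d e ⊆ Metric.closedBall (Δ.pos (Sum.inr d)) r := by
    rintro d ⟨a, b⟩ he
    refine (chord_mk d a b).subset.trans ((convex_closedBall _ _).segment_subset ?_ ?_)
    · exact Metric.sphere_subset_closedBall (hO d a (hadj d _ he a (Sym2.mem_mk_left a b))).2.2.2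
    · exact Metric.sphere_subset_closedBall (hO d b (hadj d _ he b (Sym2.mem_mk_right a b))).2.2.2
  have chord_sphere : ∀ (d : {i // y i = 1}) (e : Sym2 V), e ∈ (σ d : Sym2 (Sym2 V)) →
      ∀ p ∈ chord d e, p ∈ Metric.sphere (Δ.pos (Sum.inr d)) r → ∃ u ∈ e, p = x d u := by
    rintro d ⟨a, b⟩ he p hp hps
    have ha := hadj d _ he a (Sym2.mem_mk_left a b)
    have hb := hadj d _ he b (Sym2.mem_mk_right a b)
    have hab : a ≠ b := G.ne_of_adj (mem_edgeSet_of_mem he)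
    rcases Plane.eq_or_eq_of_mem_segment_of_mem_sphere (hO d a ha).2.2.2 (hO d b hb).2.2.2
      (hxne d a b ha hb hab) ((chord_mk d a b).subset hp) hps with h | h
    exacts [⟨a, Sym2.mem_mk_left a b, h⟩, ⟨b, Sym2.mem_mk_right a b, h⟩]
  have x_ne : ∀ (d : {i // y i = 1}) (e f : Sym2 V), e ∈ (σ d : Sym2 (Sym2 V)) →
      f ∈ (σ d : Sym2 (Sym2 V)) → e ≠ f → ∀ u ∈ e, ∀ v ∈ f, x d u ≠ x d v := by
    intro d e f he hf hef u hu v hv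
    refine hxne d u v (hadj d e he u hu) (hadj d f hf v hv) ?_
    rintro rfl
    exact independent_of_mem_of_mem he hf hef u hu hv
  -- an edge in no chosen pair keeps its arc, an edge in the pair of `d` runs along `O d u`, its
  -- chord, and `O d v`; exactly one of the two alternatives is available for each edge
  let arc : Sym2 V → Set Plane := fun e =>
    {p | (∃ h : Sym2.map Sum.inl e ∈ (G.dummyGraph σ y).edgeSet, p ∈ Δ.arc ⟨_, h⟩) ∨
      ∃ d : {i // y i = 1}, e ∈ (σ d : Sym2 (Sym2 V)) ∧ ((∃ u ∈ e, p ∈ O d u) ∨ p ∈ chord d e)}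
  -- two edges of `G` can meet, outside the vertices, only inside a disc around a dummy vertex
  have key : ∀ e f p, e ≠ f → p ∈ arc e → p ∈ arc f → (∀ v, Δ.pos (Sum.inl v) ≠ p) →
      ∃ d : {i // y i = 1}, e ∈ (σ d : Sym2 (Sym2 V)) ∧ f ∈ (σ d : Sym2 (Sym2 V)) ∧
        p ∈ Metric.ball (Δ.pos (Sum.inr d)) r ∧ p ∈ chord d e ∧ p ∈ chord d f := by
    -- the points of an arc are of three kinds: on an arc kept from `Δ`, outside the disc on a
    -- rerouted edge, or on a chord; all combinations but chord and chord are impossible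
    have kept_half : ∀ (e f : Sym2 V) (h : Sym2.map Sum.inl e ∈ (G.dummyGraph σ y).edgeSet)
        (d : {i // y i = 1}) u p, f ∈ (σ d : Sym2 (Sym2 V)) → u ∈ f → p ∈ Δ.arc ⟨_, h⟩ → p ∈ O d u →
        (∀ v, Δ.pos (Sum.inl v) ≠ p) → False := by
      intro e f h d u p hf hu hp hp' hv
      have ha := hadj d f hf u hu
      obtain ⟨w, rfl, hw, -⟩ := hmeet ⟨_, h⟩ ⟨_, ha⟩ p (fun h => by
        have : (Sum.inr d : V ⊕ {i // y i = 1}) ∈ Sym2.map Sum.inl e := by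
          rw [show Sym2.map Sum.inl e = _ from congrArg Subtype.val h]
          simp
        simp at this) hp ((hO d u ha).2.1 hp')
      obtain ⟨v, -, rfl⟩ := Sym2.mem_map.1 hw
      exact hv v rfl
    have kept_chord : ∀ (e f : Sym2 V) (h : Sym2.map Sum.inl e ∈ (G.dummyGraph σ y).edgeSet)
        (d : {i // y i = 1}) p, f ∈ (σ d : Sym2 (Sym2 V)) → p ∈ Δ.arc ⟨_, h⟩ → p ∈ chord d f → False := by
      intro e f h d p hf hp hp'
      exact Set.disjoint_left.1 (harc (Sum.inr d) ⟨_, h⟩ (by simp)) (chord_ball d f hf hp') hp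
    have half_chord : ∀ (e f : Sym2 V) (d d' : {i // y i = 1}) u p, e ≠ f →
        e ∈ (σ d : Sym2 (Sym2 V)) → f ∈ (σ d' : Sym2 (Sym2 V)) → u ∈ e → p ∈ O d u →
        p ∈ chord d' f → False := by
      intro e f d d' u p hef he hf hu hp hp'
      have ha := hadj d e he u hu
      have hpb := chord_ball d' f hf hp'
      obtain rfl | hd := eq_or_ne d d'
      · obtain rfl := hOball d u p ha hp hpb
        obtain ⟨v, hv, huv⟩ := chord_sphere d f hf _ hp' (hO d u ha).2.2.2
        exact x_ne d e f he hf hef u hu v hv huv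
      · exact Set.disjoint_left.1 (harc (Sum.inr d') ⟨_, ha⟩ (by simpa using hd.symm)) hpb
          ((hO d u ha).2.1 hp)
    rintro e f p hef (⟨h, hp⟩ | ⟨d, he, ⟨u, hu, hp⟩ | hp⟩)
      (⟨h', hp'⟩ | ⟨d', hf, ⟨u', hu', hp'⟩ | hp'⟩) hv
    · obtain ⟨w, rfl, hw, -⟩ := hmeet ⟨_, h⟩ ⟨_, h'⟩ p (fun h => hef
        (Sym2.map.injective Sum.inl_injective (congrArg Subtype.val h))) hp hp'
      obtain ⟨v, -, rfl⟩ := Sym2.mem_map.1 hw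
      exact absurd rfl (hv v)
    · exact (kept_half e f h d' u' p hf hu' hp hp' hv).elim
    · exact (kept_chord e f h d' p hf hp hp').elim
    · exact (kept_half f e h' d u p he hu hp' hp hv).elim
    · rcases hOmeet d d' u u' p (hadj d e he u hu) (hadj d' f hf u' hu') hp hp' with
        ⟨rfl, rfl⟩ | ⟨-, rfl⟩
      · exact absurd hu' (independent_of_mem_of_mem he hf hef u hu)
      · exact absurd rfl (hv u)
    · exact (half_chord e f d d' u p hef he hf hu hp hp').elim
    · exact (kept_chord f e h' d p he hp' hp).elim
    · exact (half_chord f e d' d u' p hef.symm hf he hu' hp' hp).elim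
    · have hpb := chord_ball d e he hp
      obtain rfl : d = d' := by
        by_contra hd
        exact Set.disjoint_left.1 (hball (Sum.inr d) (Sum.inr d') (by simpa using hd)) hpb
          (chord_ball d' f hf hp')
      -- on the circle, the two chords would have a common end
      refine ⟨d, he, hf, (Metric.mem_closedBall.1 hpb).lt_of_ne fun hps => ?_, hp, hp'⟩
      obtain ⟨u, hu, rfl⟩ := chord_sphere d e he p hp hps
      obtain ⟨v, hv, huv⟩ := chord_sphere d f hf _ hp' hps
      exact x_ne d e f he hf hef u hu v hv huv
  -- inside a disc a rerouted edge is exactly its chord, as the definition of a crossing requires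
  have arc_ball : ∀ (d : {i // y i = 1}) (e : Sym2 V), e ∈ (σ d : Sym2 (Sym2 V)) →
      ∀ p ∈ Metric.ball (Δ.pos (Sum.inr d)) r, p ∈ arc e ↔ p ∈ chord d e := by
    intro d e he p hp
    constructor
    · rintro (⟨h, -⟩ | ⟨d', he', ⟨u, hu, hp'⟩ | hp'⟩)
      · exact absurd he ((map_inl_mem_edgeSet_dummyGraph.1 h).2 _ d.2)
      · obtain rfl := hpairs d d' e he he'
        have ha := hadj d e he u hu
        rw [hOball d u p ha hp' (Metric.ball_subset_closedBall hp)] at hp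
        exact absurd (Metric.mem_sphere.1 (hO d u ha).2.2.2) (Metric.mem_ball.1 hp).ne
      · obtain rfl := hpairs d d' e he he'
        exact hp'
    · exact fun hp' => Or.inr ⟨d, he, Or.inr hp'⟩
  have arc_kept : ∀ e (h : Sym2.map Sum.inl e ∈ (G.dummyGraph σ y).edgeSet),
      arc e = Δ.arc ⟨_, h⟩ := by
    intro e h
    ext p
    constructor
    · rintro (⟨_, hp⟩ | ⟨d, he, -⟩)
      · exact hp
      · exact absurd he ((map_inl_mem_edgeSet_dummyGraph.1 h).2 _ d.2)
    · exact fun hp => Or.inl ⟨h, hp⟩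
  have arc_rerouted : ∀ (d : {i // y i = 1}) (a b : V), s(a, b) ∈ (σ d : Sym2 (Sym2 V)) →
      arc s(a, b) = (O d a ∪ segment ℝ (x d a) (x d b)) ∪ O d b := by
    intro d a b he
    ext p
    constructor
    · rintro (⟨h, -⟩ | ⟨d', he', ⟨u, hu, hp⟩ | hp⟩)
      · exact absurd he ((map_inl_mem_edgeSet_dummyGraph.1 h).2 _ d.2)
      · obtain rfl := hpairs d d' _ he he'
        obtain rfl | rfl := Sym2.mem_iff.1 hu
        exacts [Or.inl (Or.inl hp), Or.inr hp]
      · obtain rfl := hpairs d d' _ he he'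
        exact Or.inl (Or.inr ((chord_mk d a b).subset hp))
    · rintro ((hp | hp) | hp)
      · exact Or.inr ⟨d, he, Or.inl ⟨a, Sym2.mem_mk_left a b, hp⟩⟩
      · exact Or.inr ⟨d, he, Or.inr ⟨a, b, rfl, hp⟩⟩
      · exact Or.inr ⟨d, he, Or.inl ⟨b, Sym2.mem_mk_right a b, hp⟩⟩
  have harcs : ∀ u v, G.Adj u v →
      IsJordanArc (arc s(u, v)) (Δ.pos (Sum.inl u)) (Δ.pos (Sum.inl v)) := by
    intro a b hab
    by_cases hd : ∀ i, y i = 1 → s(a, b) ∉ (σ i : Sym2 (Sym2 V))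
    · have h : Sym2.map Sum.inl s(a, b) ∈ (G.dummyGraph σ y).edgeSet :=
        map_inl_mem_edgeSet_dummyGraph.2 ⟨hab, hd⟩
      rw [arc_kept _ h]
      exact Δ.isJordanArc rfl
    · push Not at hd
      obtain ⟨i, hi, he⟩ := hd
      have ha := hadj ⟨i, hi⟩ _ he a (Sym2.mem_mk_left a b)
      have hb := hadj ⟨i, hi⟩ _ he b (Sym2.mem_mk_right a b)
      have hseg := (chord_mk ⟨i, hi⟩ a b).symm.subset.trans (chord_ball ⟨i, hi⟩ _ he)
      rw [arc_rerouted ⟨i, hi⟩ a b he]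
      refine ((hO _ a ha).1.union (isJordanArc_segment (hxne _ a b ha hb hab.ne)) ?_).union
        (hO _ b hb).1.symm ?_
      · exact fun p hp => hOball _ a p ha hp.1 (hseg hp.2)
      · rintro p ⟨hp | hp, hp'⟩
        · exact absurd hp' (Set.disjoint_left.1 (hOdisj _ a b ha hb hab.ne) hp)
        · exact hOball _ b p hb hp' (hseg hp)
  have hvertex : ∀ (e : G.edgeSet) (w : V), Δ.pos (Sum.inl w) ∈ arc e → w ∈ (e : Sym2 V) := by
    rintro e w (⟨h, hp⟩ | ⟨d, he, ⟨u, hu, hp⟩ | hp⟩)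
    · simpa using Δ.mem_of_pos_mem_arc _ _ hp
    · have := Δ.mem_of_pos_mem_arc _ _ ((hO d u (hadj d e he u hu)).2.1 hp)
      simp at this
      rwa [this]
    · exact absurd (chord_ball d e he hp) (hpos _ _ (by simp))
  have keyG : ∀ (e f : G.edgeSet) (p : Plane), e ≠ f → p ∈ arc e → p ∈ arc f →
      p ∉ range (fun v => Δ.pos (Sum.inl v)) →
      ∃ d : {i // y i = 1}, (e : Sym2 V) ∈ (σ d : Sym2 (Sym2 V)) ∧
        (f : Sym2 V) ∈ (σ d : Sym2 (Sym2 V)) ∧ p ∈ Metric.ball (Δ.pos (Sum.inr d)) r ∧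
        p ∈ chord d e ∧ p ∈ chord d f :=
    fun e f p hef he hf hp => key e f p (fun h => hef (Subtype.ext h)) he hf
      fun v hv => hp ⟨v, hv⟩
  have pair_eq : ∀ (d : {i // y i = 1}) (e f : G.edgeSet), e ≠ f →
      (e : Sym2 V) ∈ (σ d : Sym2 (Sym2 V)) → (f : Sym2 V) ∈ (σ d : Sym2 (Sym2 V)) →
      (σ d : Sym2 (Sym2 V)) = s((e : Sym2 V), (f : Sym2 V)) :=
    fun d e f hef he hf => (Sym2.mem_and_mem_iff fun h => hef (Subtype.ext h)).1 ⟨he, hf⟩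
  -- a pair of edges has room for only one partner of `e`
  have third : ∀ (d : {i // y i = 1}) (e f g : G.edgeSet), e ≠ f → e ≠ g →
      (e : Sym2 V) ∈ (σ d : Sym2 (Sym2 V)) → (f : Sym2 V) ∈ (σ d : Sym2 (Sym2 V)) →
      (g : Sym2 V) ∈ (σ d : Sym2 (Sym2 V)) → f = g :=
    fun d e f g hef heg he hf hg => Subtype.ext (Sym2.congr_right.1
      ((pair_eq d e f hef he hf).symm.trans (pair_eq d e g heg he hg)))
  let Γ : Drawing G :=
    { pos := fun v => Δ.pos (Sum.inl v)
      arc := fun e => arc e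
      pos_injective := Δ.pos_injective.comp Sum.inl_injective
      arc_isJordanArc := harcs
      mem_of_pos_mem_arc := hvertex
      crossProperly := by
        rintro ⟨⟨a, b⟩, he⟩ ⟨⟨a', b'⟩, hf⟩ p hef hp hp' hpV
        obtain ⟨d, hed, hfd, hpd, -, -⟩ := keyG _ _ p hef hp hp' hpV
        have hne : s(a, b) ≠ s(a', b') := fun h => hef (Subtype.ext h)
        have ha := hadj d _ hed a (Sym2.mem_mk_left a b)
        have hb := hadj d _ hed b (Sym2.mem_mk_right a b)
        have ha' := hadj d _ hfd a' (Sym2.mem_mk_left a' b')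
        have hb' := hadj d _ hfd b' (Sym2.mem_mk_right a' b')
        exact Plane.crossProperlyAt_of_chords (hO d a ha).2.2.2 (hO d b hb).2.2.2
          (hO d a' ha').2.2.2 (hO d b' hb').2.2.2 (hxne d a b ha hb (G.ne_of_adj he))
          (hxne d a' b' ha' hb' (G.ne_of_adj hf))
          (x_ne d _ _ hfd hed hne.symm a' (Sym2.mem_mk_left a' b') a (Sym2.mem_mk_left a b))
          (x_ne d _ _ hfd hed hne.symm a' (Sym2.mem_mk_left a' b') b (Sym2.mem_mk_right a b))
          (fun q hq => by rw [← chord_mk]; exact arc_ball d _ hed q hq)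
          (fun q hq => by rw [← chord_mk]; exact arc_ball d _ hfd q hq) hpd hp hp'
      no_three := by
        intro e f g p hef heg hfg he hf hg
        by_contra hp
        obtain ⟨d, hed, hfd, -⟩ := keyG e f p hef he hf hp
        obtain ⟨d', hed', hgd', -⟩ := keyG e g p heg he hg hp
        obtain rfl := hpairs d d' e hed hed'
        exact hfg (third d e f g hef heg hed hfd hgd') }
  have hcross : ∀ (e f : G.edgeSet) (p : Plane), Γ.IsCrossing e f p →
      ∃ d : {i // y i = 1}, (e : Sym2 V) ∈ (σ d : Sym2 (Sym2 V)) ∧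
        (f : Sym2 V) ∈ (σ d : Sym2 (Sym2 V)) ∧ p ∈ Metric.ball (Δ.pos (Sum.inr d)) r ∧
        p ∈ chord d e ∧ p ∈ chord d f :=
    fun e f p h => keyG e f p h.1 h.2.1 h.2.2.1 h.2.2.2
  have honce : ∀ (e f : G.edgeSet) (p q : Plane), Γ.IsCrossing e f p → Γ.IsCrossing e f q →
      p = q := by
    rintro ⟨⟨a, b⟩, he⟩ ⟨⟨a', b'⟩, hf⟩ p q hp hq
    have hne : s(a, b) ≠ s(a', b') := fun h => hp.1 (Subtype.ext h)
    obtain ⟨d, hed, hfd, -, hpe, hpf⟩ := hcross _ _ _ hp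
    obtain ⟨d', hed', -, -, hqe, hqf⟩ := hcross _ _ _ hq
    obtain rfl := hpairs d d' _ hed hed'
    have ha := hadj d _ hed a (Sym2.mem_mk_left a b)
    have hb := hadj d _ hed b (Sym2.mem_mk_right a b)
    have ha' := hadj d _ hfd a' (Sym2.mem_mk_left a' b')
    have hpe := (chord_mk d a b).subset hpe
    have hqe := (chord_mk d a b).subset hqe
    have hpf := (chord_mk d a' b').subset hpf
    have hqf := (chord_mk d a' b').subset hqf
    exact Plane.eq_of_mem_chords (Plane.det_ne_zero_of_chords (hO d a ha).2.2.2 (hO d b hb).2.2.2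
      (hO d a' ha').2.2.2 (hxne d a b ha hb (G.ne_of_adj he))
      (x_ne d _ _ hfd hed hne.symm a' (Sym2.mem_mk_left a' b') a (Sym2.mem_mk_left a b))
      (x_ne d _ _ hfd hed hne.symm a' (Sym2.mem_mk_left a' b') b (Sym2.mem_mk_right a b))
      hpe hpf) hpe hpf hqe hqf
  refine ⟨Γ, ⟨?_, honce⟩, ?_⟩
  · intro e f p h
    obtain ⟨d, hed, hfd, -⟩ := hcross e f p h
    exact independent_of_mem_of_mem hed hfd fun h' => h.1 (Subtype.ext h')
  · rintro e ⟨f, p⟩ hp ⟨g, q⟩ hq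
    have hp : Γ.IsCrossing e f p := hp
    have hq : Γ.IsCrossing e g q := hq
    obtain ⟨d, hed, hfd, -⟩ := hcross e f p hp
    obtain ⟨d', hed', hgd', -⟩ := hcross e g q hq
    obtain rfl := hpairs d d' e hed hed'
    obtain rfl := third d e f g hp.1 hq.1 hed hfd hgd'
    rw [honce e f p q hp hq]

end SimpleGraph

theorem lemma1 {V : Type*} [Finite V] (G : SimpleGraph V) {k : ℕ}
    (σ : Fin k ≃ G.independentPairs) :
    G.IsOnePlanar ↔ ∃ y : Fin k → Fin 2, G.IsTrueSolution σ y :=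
  ⟨fun h => h.exists_isTrueSolution σ, fun ⟨_, h⟩ => h.isOnePlanar⟩
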